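/- Let $\eta\in\mathbb{N}$, $w\in\mathbb{R}^\eta$, $b\in\mathbb{R}$, $L,U\in\mathbb{R}^\eta$, let $[L,U]=\{x\in\mathbb{R}^\eta : L_i\le x_i\le U_i \text{ for all } i\}$, let $f(x)=w\cdot x+b$ on $[L,U]$, and let $\mathrm{ReLU}(v)=\max\{0,v\}$. For each $i\in\{1,\dots,\eta\}$ put $(\breve L_i,\breve U_i)=(L_i,U_i)$ if $w_i\ge 0$ and $(\breve L_i,\breve U_i)=(U_i,L_i)$ if $w_i<0$. Consider the system in the variables $(x,y,z)\in\mathbb{R}^\eta\times\mathbb{R}\times\mathbb{R}$ \begin{align} y &\le \sum_{i\in I} w_i\bigl(x_i-\breve L_i(1-z)\bigr)+\Bigl(b+\sum_{i\notin I}w_i\breve U_i\Bigr)z \qquad\text{for all } I\subseteq\{1,\dots,\eta\},\tag{a}\\ y &\ge w\cdot x+b,\tag{b}\\ (x,y,z)&\in[L,U]\times\mathbb{R}_{\ge 0}\times[0,1],\tag{c}\\ z&\in\{0,1\}.\tag{d} \end{align} Let $Q$ be the polyhedron of all $(x,y,z)$ satisfying (a)--(c), and let $\underline{Q}=\{(x,y,z)\in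 Q : z\in\{0,1\}\}$. 1. The system is an ideal, non-extended (no auxiliary continuous variables) mixed-integer programming formulation of the graph $\operatorname{gr}(\mathrm{ReLU}\circ f;[L,U])=\{(x,y)\in\mathbb{R}^{\eta+1} : x\in[L,U],\ y=\max\{0,f(x)\}\}$. That is, the projection of $\underline{Q}$ onto the variables $(x,y)$ equals this graph, and every extreme point of $Q$ has $z\in\{0,1\}$. 2. Assume moreover that the neuron is irreducible, i.e. there are $x^+,x^-\in[L,U]$ with $f(x^+)>0$ and $f(x^-)<0$. Then each inequality of the family (a) and the inequality (b) is facet-defining: every point of $\underline{Q}$ satisfies it, and the set of points of $\underline{Q}$ satisfying it at equality has dimension (of its affine hull) exactly one less than the dimension of $\underline{Q}$. -/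

import Mathlib

namespace NeuronMIP

/-- The space of points `(x, y, v, z)`: inputs `x ∈ ℝⁿ`, output `y ∈ ℝ`, auxiliary continuous
variables `v ∈ ℝʰ` and auxiliary (relaxed) binary variables `z ∈ ℝ^q`. -/
abbrev VarSpace (n h q : ℕ) : Type :=
  (Fin n → ℝ) × ℝ × (Fin h → ℝ) × (Fin q → ℝ)

/-- A linear inequality `lhs ≤ rhs`; both sides are affine functions of the variables. -/
structure LinIneq (n h q : ℕ) where
  lhs : VarSpace n h q →ᵃ[ℝ] ℝ
  rhs : VarSpace n h q →ᵃ[ℝ] ℝ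

/-- The point `p` satisfies the inequality. -/
def LinIneq.Holds {n h q : ℕ} (c : LinIneq n h q) (p : VarSpace n h q) : Prop :=
  c.lhs p ≤ c.rhs p

/-- The point `p` satisfies the inequality at equality. -/
def LinIneq.Tight {n h q : ℕ} (c : LinIneq n h q) (p : VarSpace n h q) : Prop :=
  c.lhs p = c.rhs p

/-- A mixed-integer system: finitely many linear inequalities in `(x, y, v, z)`, to be combined
with the integrality constraints `z ∈ {0,1}^q`. -/
structure MIPSystem (n h q : ℕ) where
  constraints : Set (LinIneq n h q)
  finite_constraints : constraints.Finite

/-- The points whose `z`-part lies in `{0,1}^q`. -/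
def binaryPoints (n h q : ℕ) : Set (VarSpace n h q) :=
  {p | ∀ j, p.2.2.2 j = 0 ∨ p.2.2.2 j = 1}

/-- The LP relaxation: the polyhedron `Q` defined by the linear inequalities. -/
def MIPSystem.relaxation {n h q : ℕ} (F : MIPSystem n h q) : Set (VarSpace n h q) :=
  {p | ∀ c ∈ F.constraints, c.Holds p}

/-- The integer feasible points, i.e. the points of `Q` with `z ∈ {0,1}^q`. -/
def MIPSystem.feasible {n h q : ℕ} (F : MIPSystem n h q) : Set (VarSpace n h q) :=
  F.relaxation ∩ binaryPoints n h q

/-- `F` is a (valid) MIP formulation of `S`: the projection of its integer feasible points onto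
the variables `(x, y)` is `S`. -/
def MIPSystem.IsFormulationOf {n h q : ℕ} (F : MIPSystem n h q) (S : Set ((Fin n → ℝ) × ℝ)) :
    Prop :=
  S = {s | ∃ (v : Fin h → ℝ) (z : Fin q → ℝ), (s.1, s.2, v, z) ∈ F.feasible}

/-- `F` is an ideal MIP formulation of `S`: it is a MIP formulation of `S`, and every extreme point
of its LP relaxation has a binary `z`-part. -/
def MIPSystem.IsIdealFormulationOf {n h q : ℕ} (F : MIPSystem n h q)
    (S : Set ((Fin n → ℝ) × ℝ)) : Prop :=
  F.IsFormulationOf S ∧ Set.extremePoints ℝ F.relaxation ⊆ binaryPoints n h q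

open Classical in
/-- The dimension of a set of points: the dimension of its affine hull, and `-1` if it is empty. -/
noncomputable def setDim {E : Type*} [AddCommGroup E] [Module ℝ E] (s : Set E) : ℤ :=
  if s.Nonempty then (Module.finrank ℝ (affineSpan ℝ s).direction : ℤ) else -1

/-- The inequality `c` is satisfied by all integer feasible points. -/
def MIPSystem.IsValid {n h q : ℕ} (F : MIPSystem n h q) (c : LinIneq n h q) : Prop :=
  ∀ p ∈ F.feasible, c.Holds p

/-- The inequality `c` is valid, and the integer feasible points satisfying it at equality have
dimension exactly one less than the set of all integer feasible points. -/
def MIPSystem.IsFacetDefining {n h q : ℕ} (F : MIPSystem n h q) (c : LinIneq n h q) : Prop :=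
  F.IsValid c ∧ setDim {p | p ∈ F.feasible ∧ c.Tight p} = setDim F.feasible - 1

/-- A neuron `x ↦ max_k f k x` on the domain `D` is irreducible: each `f k` is, somewhere on `D`,
strictly larger than all the others. -/
def IsIrreducibleNeuron {n d : ℕ} (D : Set (Fin n → ℝ)) (f : Fin d → (Fin n → ℝ) → ℝ) : Prop :=
  ∀ k, ∃ x ∈ D, ∀ l, l ≠ k → f l x < f k x

/-- The rectified linear unit. -/
noncomputable def relu (v : ℝ) : ℝ := max 0 v

/-- The affine function `x ↦ w · x + b`. -/
def affineFn {n : ℕ} (w : Fin n → ℝ) (b : ℝ) (x : Fin n → ℝ) : ℝ := ∑ i, w i * x i + b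

/-- The coordinate `x i` as an affine function of `(x, y, v, z)`. -/
def xVar {n h q : ℕ} (i : Fin n) : VarSpace n h q →ᵃ[ℝ] ℝ :=
  (LinearMap.proj i ∘ₗ LinearMap.fst ℝ (Fin n → ℝ) (ℝ × (Fin h → ℝ) × (Fin q → ℝ))).toAffineMap

/-- The output `y` as an affine function of `(x, y, v, z)`. -/
def yVar {n h q : ℕ} : VarSpace n h q →ᵃ[ℝ] ℝ :=
  (LinearMap.fst ℝ ℝ ((Fin h → ℝ) × (Fin q → ℝ)) ∘ₗ
    LinearMap.snd ℝ (Fin n → ℝ) (ℝ × (Fin h → ℝ) × (Fin q → ℝ))).toAffineMap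

/-- The coordinate `z j` as an affine function of `(x, y, v, z)`. -/
def zVar {n h q : ℕ} (j : Fin q) : VarSpace n h q →ᵃ[ℝ] ℝ :=
  (LinearMap.proj j ∘ₗ LinearMap.snd ℝ (Fin h → ℝ) (Fin q → ℝ) ∘ₗ
    LinearMap.snd ℝ ℝ ((Fin h → ℝ) × (Fin q → ℝ)) ∘ₗ
    LinearMap.snd ℝ (Fin n → ℝ) (ℝ × (Fin h → ℝ) × (Fin q → ℝ))).toAffineMap

/-- The constant function `a` as an affine function of `(x, y, v, z)`. -/
def cst {n h q : ℕ} (a : ℝ) : VarSpace n h q →ᵃ[ℝ] ℝ := AffineMap.const ℝ (VarSpace n h q) a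

@[simp] theorem xVar_apply {n h q : ℕ} (i : Fin n) (p : VarSpace n h q) : xVar i p = p.1 i := rfl

@[simp] theorem yVar_apply {n h q : ℕ} (p : VarSpace n h q) : yVar p = p.2.1 := rfl

@[simp] theorem zVar_apply {n h q : ℕ} (j : Fin q) (p : VarSpace n h q) :
    zVar j p = p.2.2.2 j := rfl

@[simp] theorem cst_apply {n h q : ℕ} (a : ℝ) (p : VarSpace n h q) : cst a p = a := rfl

/-- `L̆ i`: the endpoint of `[L i, U i]` at which `w i * x i` is smallest. -/
noncomputable def breveL {n : ℕ} (w L U : Fin n → ℝ) (i : Fin n) : ℝ :=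
  if 0 ≤ w i then L i else U i

/-- `Ŭ i`: the endpoint of `[L i, U i]` at which `w i * x i` is largest. -/
noncomputable def breveU {n : ℕ} (w L U : Fin n → ℝ) (i : Fin n) : ℝ :=
  if 0 ≤ w i then U i else L i

/-- The upper bound
`y ≤ ∑_{i ∈ I} w i (x i - L̆ i (1 - z)) + (b + ∑_{i ∉ I} w i Ŭ i) z`. -/
noncomputable def upperIneq {n : ℕ} (w : Fin n → ℝ) (b : ℝ) (L U : Fin n → ℝ)
    (I : Finset (Fin n)) : LinIneq n 0 1 where
  lhs := yVar
  rhs := ∑ i ∈ I, w i • (xVar i - breveL w L U i • (cst 1 - zVar 0)) +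
    (b + ∑ i ∈ Iᶜ, w i * breveU w L U i) • zVar 0

/-- The lower bound `y ≥ w · x + b`. -/
def lowerIneq {n : ℕ} (w : Fin n → ℝ) (b : ℝ) : LinIneq n 0 1 where
  lhs := ∑ i, w i • xVar i + cst b
  rhs := yVar

/-- The system for `ReLU ∘ f` on the box `[L, U]`: the upper bounds for all `I`, the lower bound, and
`(x, y, z) ∈ [L, U] × ℝ_{≥ 0} × [0, 1]`, with one binary variable `z` and no auxiliary continuous
variables. -/
noncomputable def reluSystem {n : ℕ} (w : Fin n → ℝ) (b : ℝ) (L U : Fin n → ℝ) :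
    MIPSystem n 0 1 where
  constraints :=
    Set.range (upperIneq w b L U) ∪ {lowerIneq w b} ∪
      Set.range (fun i => ⟨cst (L i), xVar i⟩) ∪ Set.range (fun i => ⟨xVar i, cst (U i)⟩) ∪
      {⟨cst 0, yVar⟩, ⟨cst 0, zVar 0⟩, ⟨zVar 0, cst 1⟩}
  finite_constraints :=
    ((((Set.finite_range _).union (Set.finite_singleton _)).union (Set.finite_range _)).union
      (Set.finite_range _)).union (Set.toFinite _)

/-- The LP relaxation of `reluSystem`, written out. -/
theorem mem_reluSystem_relaxation {n : ℕ} (w : Fin n → ℝ) (b : ℝ) (L U : Fin n → ℝ)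
    (x : Fin n → ℝ) (y : ℝ) (v : Fin 0 → ℝ) (z : Fin 1 → ℝ) :
    (x, y, v, z) ∈ (reluSystem w b L U).relaxation ↔
      (∀ I : Finset (Fin n), y ≤ ∑ i ∈ I, w i * (x i - breveL w L U i * (1 - z 0)) +
        (b + ∑ i ∈ Iᶜ, w i * breveU w L U i) * z 0) ∧
      affineFn w b x ≤ y ∧ x ∈ Set.Icc L U ∧ 0 ≤ y ∧ z 0 ∈ Set.Icc (0 : ℝ) 1 := by
  have hsum : ∀ (s : Finset (Fin n)) (g : Fin n → (VarSpace n 0 1 →ᵃ[ℝ] ℝ)) (p : VarSpace n 0 1),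
      (∑ i ∈ s, g i) p = ∑ i ∈ s, g i p := by
    intro s g p
    induction s using Finset.induction_on with
    | empty => simp
    | insert a s ha ih => simp [Finset.sum_insert ha, ih]
  simp only [MIPSystem.relaxation, reluSystem, Set.mem_ofPred_eq, Set.mem_union, Set.mem_range,
    Set.mem_singleton_iff, Set.mem_insert_iff, or_imp, forall_and, forall_exists_index,
    forall_apply_eq_imp_iff, forall_eq, LinIneq.Holds, upperIneq, lowerIneq, affineFn,
    Set.mem_Icc, Pi.le_def]
  simp [hsum]
  tauto

end NeuronMIP

namespace NeuronMIP

/-! ### Validity of the formulation and integrality of the extreme points. -/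

section Box

variable {n : ℕ} {w L U x : Fin n → ℝ} {b : ℝ}

/-! Write `f` for `affineFn w b`. For binary `z`, two members of (a) suffice: `I = ∅` forces `y ≤ 0`
at `z = 0`, and `I = univ` forces `y ≤ f x` at `z = 1`.

For fractional `z`, the family (a) says that `y ≤ z * f (t / z)` for the best splitting `x = (x - t)
+ t` between `(1 - z) • [L, U]` and `z • [L, U]`. This maximum separates over coordinates, each
being the smaller of two terms, and `I` records which one. Since also `z * f x ≤ y`, an intermediate
value argument makes the point a proper convex combination of `(x₀, 0, 0)` and `(x₁, f x₁, 1)`, both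
feasible (`exists_split_eq`), so it is not extreme.

For the facets, irreducibility gives `f L̆ < 0 < f Ŭ`, so coordinates can be moved slightly at
either corner without losing feasibility. Moves that preserve tightness, plus one direction changing
`z`, generate all feasible directions parallel to the hyperplane; `setDim_eq_sub_one` then gives
codimension one. -/

theorem breveL_mem (hLU : L ≤ U) : breveL w L U ∈ Set.Icc L U := by
  refine ⟨fun i => ?_, fun i => ?_⟩ <;> unfold breveL <;> split_ifs
  · exact le_rfl
  · exact hLU i
  · exact hLU i
  · exact le_rfl

theorem breveU_mem (hLU : L ≤ U) : breveU w L U ∈ Set.Icc L U := by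
  refine ⟨fun i => ?_, fun i => ?_⟩ <;> unfold breveU <;> split_ifs
  · exact hLU i
  · exact le_rfl
  · exact le_rfl
  · exact hLU i

theorem mul_breveL_le (hx : x ∈ Set.Icc L U) (i : Fin n) : w i * breveL w L U i ≤ w i * x i := by
  unfold breveL
  split_ifs with h
  · exact mul_le_mul_of_nonneg_left (hx.1 i) h
  · exact mul_le_mul_of_nonpos_left (hx.2 i) (not_le.mp h).le

theorem mul_le_breveU (hx : x ∈ Set.Icc L U) (i : Fin n) : w i * x i ≤ w i * breveU w L U i := by
  unfold breveU
  split_ifs with h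
  · exact mul_le_mul_of_nonneg_left (hx.2 i) h
  · exact mul_le_mul_of_nonpos_left (hx.1 i) (not_le.mp h).le

theorem breveU_sub_breveL_ne_zero {i : Fin n} (h : L i ≠ U i) :
    breveU w L U i - breveL w L U i ≠ 0 := by
  unfold breveU breveL
  split_ifs
  · exact sub_ne_zero.mpr h.symm
  · exact sub_ne_zero.mpr h

theorem affineFn_breveL_le (hx : x ∈ Set.Icc L U) :
    affineFn w b (breveL w L U) ≤ affineFn w b x :=
  add_le_add_left (Finset.sum_le_sum fun i _ => mul_breveL_le hx i) b

theorem affineFn_le_breveU (hx : x ∈ Set.Icc L U) :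
    affineFn w b x ≤ affineFn w b (breveU w L U) :=
  add_le_add_left (Finset.sum_le_sum fun i _ => mul_le_breveU hx i) b

theorem affineFn_add_smul (x d : Fin n → ℝ) (c : ℝ) :
    affineFn w b (x + c • d) = affineFn w b x + c * ∑ i, w i * d i := by
  simp only [affineFn, Pi.add_apply, Pi.smul_apply, smul_eq_mul, mul_add, Finset.sum_add_distrib,
    Finset.mul_sum]
  rw [Finset.sum_congr rfl fun i _ => mul_left_comm (w i) c (d i)]
  ring

theorem affineFn_add_single (x : Fin n → ℝ) (i : Fin n) (c : ℝ) :
    affineFn w b (x + Pi.single i c) = affineFn w b x + w i * c := by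
  have := affineFn_add_smul (w := w) (b := b) x (Pi.single i c) 1
  simpa [Pi.single_apply] using this

theorem sum_affineMap_apply {n h q : ℕ} {ι : Type*} (s : Finset ι)
    (g : ι → (VarSpace n h q →ᵃ[ℝ] ℝ)) (p : VarSpace n h q) :
    (∑ i ∈ s, g i) p = ∑ i ∈ s, g i p := by
  classical
  induction s using Finset.induction_on with
  | empty => simp
  | insert a s ha ih => simp [Finset.sum_insert ha, ih]

theorem upperIneq_rhs_apply (I : Finset (Fin n)) (p : VarSpace n 0 1) :
    (upperIneq w b L U I).rhs p =
      ∑ i ∈ I, w i * (p.1 i - breveL w L U i * (1 - p.2.2.2 0)) +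
        (b + ∑ i ∈ Iᶜ, w i * breveU w L U i) * p.2.2.2 0 := by
  simp [upperIneq, sum_affineMap_apply]

theorem lowerIneq_lhs_apply (p : VarSpace n 0 1) :
    (lowerIneq w b).lhs p = affineFn w b p.1 := by
  simp [lowerIneq, affineFn, sum_affineMap_apply]

theorem affineFn_le_sum_add_sum_compl (hx : x ∈ Set.Icc L U) (I : Finset (Fin n)) :
    affineFn w b x ≤ ∑ i ∈ I, w i * x i + (b + ∑ i ∈ Iᶜ, w i * breveU w L U i) := by
  have h := Finset.sum_add_sum_compl I fun i => w i * x i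
  have h' : ∑ i ∈ Iᶜ, w i * x i ≤ ∑ i ∈ Iᶜ, w i * breveU w L U i :=
    Finset.sum_le_sum fun i _ => mul_le_breveU hx i
  unfold affineFn
  linarith

theorem mem_feasible_iff {p : VarSpace n 0 1} :
    p ∈ (reluSystem w b L U).feasible ↔ p.1 ∈ Set.Icc L U ∧
      ((p.2.2.2 0 = 0 ∧ p.2.1 = 0 ∧ affineFn w b p.1 ≤ 0) ∨
        (p.2.2.2 0 = 1 ∧ p.2.1 = affineFn w b p.1 ∧ 0 ≤ affineFn w b p.1)) := by
  obtain ⟨x, y, v, z⟩ := p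
  simp only [MIPSystem.feasible, Set.mem_inter_iff, mem_reluSystem_relaxation, binaryPoints,
    Set.mem_ofPred_eq, Fin.forall_fin_one]
  constructor
  · rintro ⟨⟨hI, hf, hx, hy, -⟩, hz | hz⟩
    · have h0 := hI ∅
      simp only [hz, Finset.sum_empty, mul_zero, add_zero] at h0
      exact ⟨hx, .inl ⟨hz, le_antisymm h0 hy, hf.trans h0⟩⟩
    · have h1 := hI Finset.univ
      simp only [hz, sub_self, mul_zero, sub_zero, Finset.compl_univ, Finset.sum_empty, add_zero,
        mul_one] at h1
      have hyf : y = affineFn w b x := le_antisymm h1 hf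
      exact ⟨hx, .inr ⟨hz, hyf, hyf ▸ hy⟩⟩
  · rintro ⟨hx, ⟨hz, rfl, hf⟩ | ⟨hz, rfl, hf⟩⟩
    · refine ⟨⟨fun I => ?_, hf, hx, le_rfl, by simp [hz]⟩, .inl hz⟩
      simp only [hz, sub_zero, mul_one, mul_zero, add_zero]
      exact Finset.sum_nonneg fun i _ => by
        rw [mul_sub]
        exact sub_nonneg.mpr (mul_breveL_le hx i)
    · refine ⟨⟨fun I => ?_, le_rfl, hx, hf, by simp [hz]⟩, .inr hz⟩
      simpa only [hz, sub_self, mul_zero, sub_zero, mul_one] using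
        affineFn_le_sum_add_sum_compl hx I

theorem reluSystem_isFormulationOf (w : Fin n → ℝ) (b : ℝ) (L U : Fin n → ℝ) :
    (reluSystem w b L U).IsFormulationOf (Set.graphOn (relu ∘ affineFn w b) (Set.Icc L U)) := by
  ext ⟨x, y⟩
  simp only [Set.mem_graphOn, Function.comp_apply, relu, Set.mem_ofPred_eq, mem_feasible_iff]
  constructor
  · rintro ⟨hx, rfl⟩
    rcases le_total (affineFn w b x) 0 with h | h
    · exact ⟨0, 0, hx, .inl ⟨rfl, max_eq_left h, h⟩⟩
    · exact ⟨0, 1, hx, .inr ⟨rfl, max_eq_right h, h⟩⟩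
  · rintro ⟨-, z, hx, ⟨-, rfl, h⟩ | ⟨-, rfl, h⟩⟩
    · exact ⟨hx, max_eq_left h⟩
    · exact ⟨hx, max_eq_right h⟩

/-- Splitting `x = (x - t) + t` with `t ∈ z • [l, u]` and `x - t ∈ (1 - z) • [l, u]` so that `a * t`
is as large as possible. -/
theorem exists_maximal_split {a l u x z : ℝ} (hx : x ∈ Set.Icc l u) (hz : z ∈ Set.Icc (0 : ℝ) 1) :
    ∃ t, z * l ≤ t ∧ t ≤ z * u ∧ (1 - z) * l ≤ x - t ∧ x - t ≤ (1 - z) * u ∧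
      (a * t = a * (if 0 ≤ a then u else l) * z ∨
        a * t = a * (x - (if 0 ≤ a then l else u) * (1 - z))) := by
  obtain ⟨h1, h2⟩ := hx
  obtain ⟨h3, h4⟩ := hz
  split_ifs
  · rcases le_total (z * u) (x - l * (1 - z)) with h | h
    · exact ⟨z * u, by nlinarith, le_rfl, by nlinarith, by nlinarith, .inl (by ring)⟩
    · exact ⟨x - l * (1 - z), by nlinarith, h, by nlinarith, by nlinarith, .inr rfl⟩
  · rcases le_total (z * l) (x - u * (1 - z)) with h | h
    · exact ⟨x - u * (1 - z), h, by nlinarith, by nlinarith, by nlinarith, .inr rfl⟩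
    · exact ⟨z * l, le_rfl, by nlinarith, by nlinarith, by nlinarith, .inl (by ring)⟩

/-- The coordinatewise best splitting attains the minimum over `I` of the right-hand sides of (a),
so a single member of the family bounds `y`. -/
theorem exists_split_le {y z : ℝ} (hx : x ∈ Set.Icc L U) (hz : z ∈ Set.Icc (0 : ℝ) 1)
    (h : ∀ I : Finset (Fin n), y ≤ ∑ i ∈ I, w i * (x i - breveL w L U i * (1 - z)) +
        (b + ∑ i ∈ Iᶜ, w i * breveU w L U i) * z) :
    ∃ t : Fin n → ℝ, z • L ≤ t ∧ t ≤ z • U ∧ (1 - z) • L ≤ x - t ∧ x - t ≤ (1 - z) • U ∧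
      y ≤ ∑ i, w i * t i + b * z := by
  classical
  choose t h1 h2 h3 h4 h5 using fun i =>
    exists_maximal_split (a := w i) (⟨hx.1 i, hx.2 i⟩ : x i ∈ Set.Icc (L i) (U i)) hz
  refine ⟨t, h1, h2, h3, h4, ?_⟩
  -- The member of (a) that matches the splitting: `I` collects the coordinates where the second
  -- alternative gives the value of `w i * t i`.
  let I : Finset (Fin n) :=
    Finset.univ.filter fun i => w i * t i = w i * (x i - breveL w L U i * (1 - z))
  have hI : ∑ i ∈ I, w i * (x i - breveL w L U i * (1 - z)) = ∑ i ∈ I, w i * t i :=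
    Finset.sum_congr rfl fun i hi => (Finset.mem_filter.mp hi).2.symm
  have hIc : ∑ i ∈ Iᶜ, w i * breveU w L U i * z = ∑ i ∈ Iᶜ, w i * t i :=
    Finset.sum_congr rfl fun i hi => by
      rcases h5 i with h' | h'
      · exact h'.symm
      · exact absurd (Finset.mem_filter.mpr ⟨Finset.mem_univ i, h'⟩) (Finset.mem_compl.mp hi)
  have := h I
  rw [add_mul, Finset.sum_mul, hI, hIc] at this
  have hs := Finset.sum_add_sum_compl I fun i => w i * t i
  linarith

/-- A point of the relaxation with fractional `z` is a proper convex combination of a feasible point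
with `z = 0` and one with `z = 1`. -/
theorem exists_split_eq {y z : ℝ} (hx : x ∈ Set.Icc L U) (hz : z ∈ Set.Ioo (0 : ℝ) 1)
    (hy : 0 ≤ y) (hf : affineFn w b x ≤ y)
    (h : ∀ I : Finset (Fin n), y ≤ ∑ i ∈ I, w i * (x i - breveL w L U i * (1 - z)) +
        (b + ∑ i ∈ Iᶜ, w i * breveU w L U i) * z) :
    ∃ x₀ ∈ Set.Icc L U, ∃ x₁ ∈ Set.Icc L U, (1 - z) • x₀ + z • x₁ = x ∧
      z * affineFn w b x₁ = y ∧ affineFn w b x₀ ≤ 0 := by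
  obtain ⟨hz0, hz1⟩ := hz
  have hz1' : 0 < 1 - z := sub_pos.mpr hz1
  obtain ⟨t, h1, h2, h3, h4, h5⟩ := exists_split_le hx ⟨hz0.le, hz1.le⟩ h
  have hu : z⁻¹ • t ∈ Set.Icc L U :=
    ⟨(le_inv_smul_iff_of_pos hz0).mpr h1, (inv_smul_le_iff_of_pos hz0).mpr h2⟩
  have hv : (1 - z)⁻¹ • (x - t) ∈ Set.Icc L U :=
    ⟨(le_inv_smul_iff_of_pos hz1').mpr h3, (inv_smul_le_iff_of_pos hz1').mpr h4⟩
  -- Both cases amount to `z * f x ≤ max 0 (f x) ≤ y`. This is the lower end for the intermediate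
  -- value theorem; the splitting bound is the upper end.
  have hxle : z * affineFn w b x ≤ y := by
    rcases le_total 0 (affineFn w b x) with hp | hp <;> nlinarith
  have hut : z * affineFn w b (z⁻¹ • t) = ∑ i, w i * t i + b * z := by
    have := affineFn_add_smul (w := w) (b := b) 0 t z⁻¹
    rw [zero_add] at this
    rw [this, mul_add, mul_inv_cancel_left₀ hz0.ne']
    simp [affineFn, mul_comm, add_comm]
  have hcont : Continuous fun c : ℝ => z * affineFn w b (x + c • (z⁻¹ • t - x)) := by
    simp only [affineFn_add_smul]
    fun_prop
  obtain ⟨c, hc, hcy⟩ : y ∈ (fun c : ℝ => z * affineFn w b (x + c • (z⁻¹ • t - x))) ''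
      Set.Icc 0 1 := by
    apply intermediate_value_Icc zero_le_one hcont.continuousOn
    simp only [zero_smul, add_zero, one_smul, add_sub_cancel, hut]
    exact ⟨hxle, h5⟩
  have hconv : ∀ {u : Fin n → ℝ}, u ∈ Set.Icc L U → x + c • (u - x) ∈ Set.Icc L U := fun hu =>
    (convex_Icc L U).add_smul_sub_mem hx hu hc
  -- The same parameter `c` moves both parts, and their displacements from `x` cancel in the
  -- weighted sum.
  have hcomb : (1 - z) • (x + c • ((1 - z)⁻¹ • (x - t) - x)) + z • (x + c • (z⁻¹ • t - x)) = x := by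
    ext i
    simp only [Pi.add_apply, Pi.smul_apply, Pi.sub_apply, smul_eq_mul]
    field_simp
    ring
  refine ⟨_, hconv hv, _, hconv hu, hcomb, hcy, ?_⟩
  generalize x + c • ((1 - z)⁻¹ • (x - t) - x) = x₀ at hcomb
  simp only at hcy
  generalize x + c • (z⁻¹ • t - x) = x₁ at hcomb hcy
  have hsum : (1 - z) * affineFn w b x₀ + z * affineFn w b x₁ = affineFn w b x := by
    rw [← hcomb]
    simp only [affineFn, Pi.add_apply, Pi.smul_apply, smul_eq_mul, mul_add,
      Finset.sum_add_distrib, Finset.mul_sum]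
    rw [Finset.sum_congr rfl fun i _ => mul_left_comm (1 - z) (w i) (x₀ i),
      Finset.sum_congr rfl fun i _ => mul_left_comm z (w i) (x₁ i)]
    ring
  -- The left side equals `f x - y`, so the lower bound (b) supplies the sign.
  have : (1 - z) * affineFn w b x₀ ≤ 0 := by linarith
  exact nonpos_of_mul_nonpos_right this hz1'

theorem extremePoints_relaxation_subset (w : Fin n → ℝ) (b : ℝ) (L U : Fin n → ℝ) :
    Set.extremePoints ℝ (reluSystem w b L U).relaxation ⊆ binaryPoints n 0 1 := by
  rintro ⟨x, y, v, z⟩ hp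
  obtain ⟨hmem, hext⟩ := mem_extremePoints.mp hp
  obtain ⟨hI, hf, hx, hy, hz⟩ := (mem_reluSystem_relaxation ..).mp hmem
  simp only [binaryPoints, Set.mem_ofPred_eq, Fin.forall_fin_one]
  by_contra! hne
  have hz' : z 0 ∈ Set.Ioo (0 : ℝ) 1 :=
    ⟨lt_of_le_of_ne hz.1 hne.1.symm, lt_of_le_of_ne hz.2 hne.2⟩
  obtain ⟨x₀, hx₀, x₁, hx₁, hcomb, hy₁, hf₀⟩ := exists_split_eq hx hz' hy hf hI
  have h₀ : ((x₀, 0, v, 0) : VarSpace n 0 1) ∈ (reluSystem w b L U).feasible :=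
    mem_feasible_iff.mpr ⟨hx₀, .inl ⟨rfl, rfl, hf₀⟩⟩
  have h₁ : ((x₁, affineFn w b x₁, v, 1) : VarSpace n 0 1) ∈ (reluSystem w b L U).feasible :=
    mem_feasible_iff.mpr ⟨hx₁, .inr ⟨rfl, rfl, nonneg_of_mul_nonneg_right (hy₁ ▸ hy) hz'.1⟩⟩
  have := hext _ h₀.1 _ h₁.1 ⟨1 - z 0, z 0, sub_pos.mpr hz'.2, hz'.1, sub_add_cancel _ _, by
    refine Prod.ext hcomb (Prod.ext ?_ (Prod.ext (Subsingleton.elim _ _) ?_))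
    · simpa using hy₁
    · ext j
      rw [Subsingleton.elim j 0]
      simp⟩
  exact hne.1 (congrFun (congrArg (fun p : VarSpace n 0 1 => p.2.2.2) this.1) 0).symm

end Box

/-! ### A criterion for codimension one. -/

section Dimension

variable {E : Type*} [AddCommGroup E] [Module ℝ E] [FiniteDimensional ℝ E]

/-- If `T ⊆ F` lies on the hyperplane `g = 0`, some point of `F` does not, and every direction of `F`
parallel to the hyperplane is a direction of `T`, then `T` has codimension one in `F`. -/
theorem setDim_eq_sub_one {T F : Set E} (hTF : T ⊆ F) (g : E →ᵃ[ℝ] ℝ) (hT : ∀ p ∈ T, g p = 0)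
    (hne : T.Nonempty) {q : E} (hq : q ∈ F) (hgq : g q ≠ 0)
    (hker : ∀ d ∈ vectorSpan ℝ F, g.linear d = 0 → d ∈ vectorSpan ℝ T) :
    setDim T = setDim F - 1 := by
  obtain ⟨t, ht⟩ := hne
  rw [setDim, setDim, if_pos ⟨t, ht⟩, if_pos ⟨q, hq⟩, direction_affineSpan, direction_affineSpan]
  let φ : vectorSpan ℝ F →ₗ[ℝ] ℝ := g.linear.domRestrict (vectorSpan ℝ F)
  have hlin : ∀ d ∈ vectorSpan ℝ T, g.linear d = 0 := by
    intro d hd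
    have : vectorSpan ℝ T ≤ LinearMap.ker g.linear := by
      rw [vectorSpan_def, Submodule.span_le]
      rintro _ ⟨a, ha, c, hc, rfl⟩
      rw [SetLike.mem_coe, LinearMap.mem_ker, AffineMap.linearMap_vsub, hT a ha, hT c hc, vsub_self]
    exact this hd
  have hmap : (LinearMap.ker φ).map (vectorSpan ℝ F).subtype = vectorSpan ℝ T := by
    ext d
    simp only [Submodule.mem_map, LinearMap.mem_ker, Submodule.subtype_apply, Subtype.exists]
    constructor
    · rintro ⟨d, hd, h0, rfl⟩
      exact hker d hd h0
    · intro hd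
      exact ⟨d, vectorSpan_mono ℝ hTF hd, hlin d hd, rfl⟩
  have hφ : φ ≠ 0 := by
    intro h0
    have hmem : q -ᵥ t ∈ vectorSpan ℝ F := vsub_mem_vectorSpan ℝ hq (hTF ht)
    have : g.linear (q -ᵥ t) = 0 := LinearMap.congr_fun h0 ⟨_, hmem⟩
    rw [AffineMap.linearMap_vsub, hT t ht] at this
    exact hgq (by simpa using this)
  have hrank := Module.Dual.finrank_ker_add_one_of_ne_zero hφ
  rw [← hmap, Submodule.finrank_map_subtype_eq, ← hrank]
  simp

end Dimension

/-! ### Facets, from perturbations of the two corners. -/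

section Facets

variable {n : ℕ} {w L U : Fin n → ℝ} {b : ℝ}

theorem add_single_mem_Icc {x y : Fin n → ℝ} (hx : x ∈ Set.Icc L U) (hy : y ∈ Set.Icc L U)
    (i : Fin n) {c : ℝ} (hc : c ∈ Set.Icc (0 : ℝ) 1) :
    x + Pi.single i (c * (y i - x i)) ∈ Set.Icc L U := by
  have key : ∀ j, (x + Pi.single i (c * (y i - x i)) : Fin n → ℝ) j ∈ Set.Icc (L j) (U j) := by
    intro j
    rcases eq_or_ne j i with rfl | hj
    · simpa using (convex_Icc (L j) (U j)).add_smul_sub_mem ⟨hx.1 j, hx.2 j⟩ ⟨hy.1 j, hy.2 j⟩ hc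
    · simpa [Pi.single_eq_of_ne hj] using And.intro (hx.1 j) (hx.2 j)
  exact ⟨fun j => (key j).1, fun j => (key j).2⟩

/-- A point of the box can be moved in the direction of another one along one coordinate without
changing the sign of an affine function. -/
theorem exists_perturbation {x y : Fin n → ℝ} (hx : x ∈ Set.Icc L U) (hy : y ∈ Set.Icc L U)
    {i : Fin n} (hi : y i - x i ≠ 0) (hf : affineFn w b x ≠ 0) :
    ∃ δ ≠ 0, x + Pi.single i δ ∈ Set.Icc L U ∧ |w i * δ| ≤ |affineFn w b x| := by
  have ha : 0 < |affineFn w b x| := abs_pos.mpr hf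
  set a := |affineFn w b x|
  set k := |w i * (y i - x i)| with hk
  have hk0 : 0 ≤ k := abs_nonneg _
  have hak : 0 < a + k := by positivity
  have hc : 0 < a / (a + k) := by positivity
  -- With `c = a / (a + k)`, the change in `f` has size `a * k / (a + k) ≤ a`, and `c ≤ 1` stays in
  -- the box; `k = 0` needs no separate case.
  refine ⟨a / (a + k) * (y i - x i), mul_ne_zero hc.ne' hi,
    add_single_mem_Icc hx hy i ⟨hc.le, (div_le_one hak).mpr (by linarith)⟩, ?_⟩
  rw [mul_left_comm, abs_mul, abs_of_pos hc, ← hk, div_mul_eq_mul_div, div_le_iff₀ hak]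
  nlinarith

theorem exists_perturbation_breveL (hLU : L ≤ U) (hf : affineFn w b (breveL w L U) < 0)
    {i : Fin n} (hi : L i ≠ U i) :
    ∃ δ ≠ 0, ((breveL w L U + Pi.single i δ, 0, 0, 0) : VarSpace n 0 1) ∈
      (reluSystem w b L U).feasible := by
  obtain ⟨δ, hδ, hmem, hle⟩ := exists_perturbation (breveL_mem hLU) (breveU_mem hLU)
    (breveU_sub_breveL_ne_zero hi) hf.ne
  refine ⟨δ, hδ, mem_feasible_iff.mpr ⟨hmem, .inl ⟨rfl, rfl, ?_⟩⟩⟩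
  rw [abs_of_neg hf] at hle
  simp only [affineFn_add_single]
  linarith [(abs_le.mp hle).2]

theorem exists_perturbation_breveU (hLU : L ≤ U) (hf : 0 < affineFn w b (breveU w L U))
    {i : Fin n} (hi : L i ≠ U i) :
    ∃ δ ≠ 0, ((breveU w L U + Pi.single i δ, affineFn w b (breveU w L U) + w i * δ, 0, 1) :
      VarSpace n 0 1) ∈ (reluSystem w b L U).feasible := by
  obtain ⟨δ, hδ, hmem, hle⟩ := exists_perturbation (breveU_mem hLU) (breveL_mem hLU)
    (by simpa using neg_ne_zero.mpr (breveU_sub_breveL_ne_zero (w := w) hi)) hf.ne'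
  refine ⟨δ, hδ, mem_feasible_iff.mpr ⟨hmem, .inr ⟨rfl, ?_, ?_⟩⟩⟩
  · simp only [affineFn_add_single]
  · rw [abs_of_pos hf] at hle
    simp only [affineFn_add_single]
    linarith [(abs_le.mp hle).1]

theorem breveL_mem_feasible (hLU : L ≤ U) (hf : affineFn w b (breveL w L U) < 0) :
    ((breveL w L U, 0, 0, 0) : VarSpace n 0 1) ∈ (reluSystem w b L U).feasible :=
  mem_feasible_iff.mpr ⟨breveL_mem hLU, .inl ⟨rfl, rfl, hf.le⟩⟩

theorem breveU_mem_feasible (hLU : L ≤ U) (hf : 0 < affineFn w b (breveU w L U)) :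
    ((breveU w L U, affineFn w b (breveU w L U), 0, 1) : VarSpace n 0 1) ∈
      (reluSystem w b L U).feasible :=
  mem_feasible_iff.mpr ⟨breveU_mem hLU, .inr ⟨rfl, rfl, hf.le⟩⟩

theorem upperIneq_tight_zero_iff (I : Finset (Fin n)) (x : Fin n → ℝ) :
    (upperIneq w b L U I).Tight (x, 0, 0, 0) ↔ ∑ i ∈ I, w i * (x i - breveL w L U i) = 0 := by
  rw [LinIneq.Tight, upperIneq_rhs_apply, eq_comm]
  simp [upperIneq]

/-- At `z = 1` tightness constrains only coordinates outside `I`, at `z = 0` only those in `I`.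
Hence coordinates in `I` are free at `Ŭ`, the others at `L̆`. -/
theorem upperIneq_tight_one_iff (I : Finset (Fin n)) (x : Fin n → ℝ) :
    (upperIneq w b L U I).Tight (x, affineFn w b x, 0, 1) ↔
      ∑ i ∈ Iᶜ, w i * (x i - breveU w L U i) = 0 := by
  rw [LinIneq.Tight, upperIneq_rhs_apply]
  have h := Finset.sum_add_sum_compl I fun i => w i * x i
  simp only [upperIneq, yVar_apply, affineFn, Pi.one_apply, sub_self, mul_zero, sub_zero, mul_one,
    mul_sub, Finset.sum_sub_distrib]
  constructor <;> intro h' <;> linarith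

theorem sum_mul_add_single_sub (s : Finset (Fin n)) (x : Fin n → ℝ) (i : Fin n) (δ : ℝ) :
    ∑ j ∈ s, w j * ((x + Pi.single i δ : Fin n → ℝ) j - x j) = if i ∈ s then w i * δ else 0 := by
  simp [Pi.single_apply]

/-- The box may be degenerate: a coordinate with `L i = U i` admits no perturbation, but contributes
no direction either. -/
theorem vectorSpan_feasible_apply_eq_zero {d : VarSpace n 0 1}
    (hd : d ∈ vectorSpan ℝ (reluSystem w b L U).feasible) {i : Fin n} (hi : L i = U i) :
    d.1 i = 0 := by
  have : vectorSpan ℝ (reluSystem w b L U).feasible ≤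
      LinearMap.ker (xVar (n := n) (h := 0) (q := 1) i).linear := by
    rw [vectorSpan_def, Submodule.span_le]
    rintro _ ⟨p, hp, q, hq, rfl⟩
    have h1 := (mem_feasible_iff.mp hp).1
    have h2 := (mem_feasible_iff.mp hq).1
    rw [SetLike.mem_coe, LinearMap.mem_ker, AffineMap.linearMap_vsub, xVar_apply, xVar_apply,
      vsub_eq_sub]
    linarith [h1.1 i, h1.2 i, h2.1 i, h2.2 i]
  exact this hd

/-- A submodule of the variable space which contains a vector raising `z` and, for every coordinate
in `J`, a vector raising that coordinate of `x` only, contains every combination of them. -/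
theorem mem_of_coordinate_vectors_mem {V : Submodule ℝ (VarSpace n 0 1)} {s a : Fin n → ℝ} {c : ℝ}
    {J : Set (Fin n)}
    (hs : ∀ i ∈ J, ((Pi.single i 1, s i, 0, 0) : VarSpace n 0 1) ∈ V)
    (ha : ((a, c, 0, 1) : VarSpace n 0 1) ∈ V) {d : VarSpace n 0 1}
    (hd : ∀ i ∉ J, d.1 i = 0) (haJ : ∀ i ∉ J, a i = 0)
    (hy : d.2.1 = d.2.2.2 0 * c + ∑ i, s i * (d.1 i - d.2.2.2 0 * a i)) : d ∈ V := by
  have hsum : d = d.2.2.2 0 • ((a, c, 0, 1) : VarSpace n 0 1) +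
      ∑ i, (d.1 i - d.2.2.2 0 * a i) • ((Pi.single i 1, s i, 0, 0) : VarSpace n 0 1) := by
    refine Prod.ext ?_ (Prod.ext ?_ (Prod.ext (Subsingleton.elim _ _) ?_))
    · ext j
      simp [Prod.fst_sum, Finset.sum_apply, Pi.single_apply]
    · simp only [Prod.snd_add, Prod.fst_add, Prod.smul_snd, Prod.smul_fst, Prod.snd_sum,
        Prod.fst_sum, smul_eq_mul]
      rw [hy]
      simp only [mul_comm (s _)]
    · ext j
      rw [Subsingleton.elim j 0]
      simp [Prod.snd_sum]
  rw [hsum]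
  refine V.add_mem (V.smul_mem _ ha) (V.sum_mem fun i _ => ?_)
  by_cases hi : i ∈ J
  · exact V.smul_mem _ (hs i hi)
  · rw [hd i hi, haJ i hi, mul_zero, sub_zero, zero_smul]
    exact V.zero_mem

theorem coordinate_vector_mem_vectorSpan {T : Set (VarSpace n 0 1)} {x : Fin n → ℝ} {y s δ : ℝ}
    {z : Fin 1 → ℝ} {i : Fin n} (hδ : δ ≠ 0) (h₀ : ((x, y, 0, z) : VarSpace n 0 1) ∈ T)
    (h₁ : ((x + Pi.single i δ, y + s * δ, 0, z) : VarSpace n 0 1) ∈ T) :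
    ((Pi.single i 1, s, 0, 0) : VarSpace n 0 1) ∈ vectorSpan ℝ T := by
  have h := Submodule.smul_mem _ δ⁻¹ (vsub_mem_vectorSpan ℝ h₁ h₀)
  convert h using 1
  refine Prod.ext ?_ (Prod.ext ?_ (Prod.ext (Subsingleton.elim _ _) ?_))
  · ext j
    simp only [vsub_eq_sub, Prod.smul_fst, Prod.fst_sub, add_sub_cancel_left, Pi.smul_apply,
      Pi.single_apply, smul_eq_mul]
    split_ifs <;> simp [hδ]
  · simp [mul_left_comm _ s, hδ]
  · simp

theorem exists_upperIneq_not_tight (hLU : L ≤ U) (hL : affineFn w b (breveL w L U) < 0)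
    (hU : 0 < affineFn w b (breveU w L U)) (I : Finset (Fin n)) :
    ∃ p ∈ (reluSystem w b L U).feasible, ¬ (upperIneq w b L U I).Tight p := by
  -- As `f` differs at the two corners, some coordinate has nonzero weight and nonzero width. Moving
  -- it at the corner where it is constrained breaks tightness.
  obtain ⟨i, hi⟩ : ∃ i, w i * breveL w L U i ≠ w i * breveU w L U i := by
    by_contra! h
    have : affineFn w b (breveL w L U) = affineFn w b (breveU w L U) := by simp [affineFn, h]
    linarith
  have hw : w i ≠ 0 := fun h => hi (by rw [h, zero_mul, zero_mul])
  have hLUi : L i ≠ U i := fun h => hi (by simp [breveL, breveU, h])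
  by_cases hiI : i ∈ I
  · obtain ⟨δ, hδ, hp⟩ := exists_perturbation_breveL hLU hL hLUi
    refine ⟨_, hp, ?_⟩
    rw [upperIneq_tight_zero_iff, sum_mul_add_single_sub, if_pos hiI]
    exact mul_ne_zero hw hδ
  · obtain ⟨δ, hδ, hp⟩ := exists_perturbation_breveU hLU hU hLUi
    refine ⟨_, hp, ?_⟩
    rw [← affineFn_add_single, upperIneq_tight_one_iff, sum_mul_add_single_sub,
      if_pos (Finset.mem_compl.mpr hiI)]
    exact mul_ne_zero hw hδ

theorem isFacetDefining_upperIneq (hLU : L ≤ U) (hL : affineFn w b (breveL w L U) < 0)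
    (hU : 0 < affineFn w b (breveU w L U)) (I : Finset (Fin n)) :
    (reluSystem w b L U).IsFacetDefining (upperIneq w b L U I) := by
  refine ⟨fun p hp => hp.1 _ (by simp [reluSystem]), ?_⟩
  obtain ⟨q, hq, hqt⟩ := exists_upperIneq_not_tight hLU hL hU I
  have ht₀ : ((breveL w L U, 0, 0, 0) : VarSpace n 0 1) ∈
      {p | p ∈ (reluSystem w b L U).feasible ∧ (upperIneq w b L U I).Tight p} :=
    ⟨breveL_mem_feasible hLU hL, (upperIneq_tight_zero_iff _ _).mpr (by simp)⟩
  have ht₁ : ((breveU w L U, affineFn w b (breveU w L U), 0, 1) : VarSpace n 0 1) ∈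
      {p | p ∈ (reluSystem w b L U).feasible ∧ (upperIneq w b L U I).Tight p} :=
    ⟨breveU_mem_feasible hLU hU, (upperIneq_tight_one_iff _ _).mpr (by simp)⟩
  refine setDim_eq_sub_one (fun p hp => hp.1)
    ((upperIneq w b L U I).rhs - (upperIneq w b L U I).lhs)
    (fun p hp => sub_eq_zero.mpr hp.2.symm) ⟨_, ht₀⟩ hq
    (fun h => hqt (sub_eq_zero.mp h).symm) fun d hd hgd => ?_
  -- The slope of `y` is `w i` for moves at `Ŭ` and `0` for moves at `L̆`; the direction raising `z`
  -- joins the two corners.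
  refine mem_of_coordinate_vectors_mem (J := {i | L i ≠ U i})
    (s := fun i => if i ∈ I then w i else 0) (a := breveU w L U - breveL w L U)
    (c := affineFn w b (breveU w L U)) (fun i hi => ?_) ?_
    (fun i hi => vectorSpan_feasible_apply_eq_zero hd (not_not.mp hi)) (fun i hi => ?_) ?_
  · by_cases hiI : i ∈ I
    · obtain ⟨δ, hδ, hp⟩ := exists_perturbation_breveU hLU hU hi
      rw [if_pos hiI]
      refine coordinate_vector_mem_vectorSpan hδ ht₁ ⟨hp, ?_⟩
      rw [← affineFn_add_single, upperIneq_tight_one_iff, sum_mul_add_single_sub,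
        if_neg (by simpa using hiI)]
    · obtain ⟨δ, hδ, hp⟩ := exists_perturbation_breveL hLU hL hi
      rw [if_neg hiI]
      refine coordinate_vector_mem_vectorSpan hδ ht₀ ?_
      rw [zero_mul, add_zero]
      refine ⟨hp, ?_⟩
      rw [upperIneq_tight_zero_iff, sum_mul_add_single_sub, if_neg hiI]
  · simpa using vsub_mem_vectorSpan ℝ ht₁ ht₀
  · simp [breveU, breveL, not_not.mp hi]
  · rw [AffineMap.decomp'] at hgd
    simp only [Pi.sub_apply, AffineMap.coe_sub, upperIneq_rhs_apply] at hgd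
    have h := Finset.sum_add_sum_compl I fun i => w i * breveU w L U i
    simp only [upperIneq, yVar_apply, Prod.fst_zero, Prod.snd_zero, Pi.zero_apply, mul_sub, mul_one,
      Finset.sum_sub_distrib, ite_mul, zero_mul, Finset.sum_ite_mem, Finset.univ_inter,
      Pi.sub_apply, affineFn, ← mul_assoc, ← Finset.sum_mul, mul_right_comm (w _) (d.2.2.2 0),
      mul_zero, Finset.sum_const_zero] at hgd ⊢
    linear_combination (-1 : ℝ) * hgd + d.2.2.2 0 * h

theorem isFacetDefining_lowerIneq (hLU : L ≤ U) (hL : affineFn w b (breveL w L U) < 0)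
    (hU : 0 < affineFn w b (breveU w L U)) :
    (reluSystem w b L U).IsFacetDefining (lowerIneq w b) := by
  refine ⟨fun p hp => hp.1 _ (by simp [reluSystem]), ?_⟩
  have tight_iff : ∀ p : VarSpace n 0 1, (lowerIneq w b).Tight p ↔ affineFn w b p.1 = p.2.1 :=
    fun p => by rw [LinIneq.Tight, lowerIneq_lhs_apply]; rfl
  have ht₁ : ((breveU w L U, affineFn w b (breveU w L U), 0, 1) : VarSpace n 0 1) ∈
      {p | p ∈ (reluSystem w b L U).feasible ∧ (lowerIneq w b).Tight p} :=
    ⟨breveU_mem_feasible hLU hU, (tight_iff _).mpr rfl⟩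
  -- At a zero of `f` both values of `z` are feasible and tight, which yields the pure `z`
  -- direction.
  obtain ⟨x, hx, hfx⟩ : ∃ x ∈ Set.Icc L U, affineFn w b x = 0 := by
    have hcont : Continuous (affineFn w b) := by
      unfold affineFn
      fun_prop
    exact (convex_Icc L U).isPreconnected.intermediate_value (breveL_mem hLU) (breveU_mem hLU)
      hcont.continuousOn ⟨hL.le, hU.le⟩
  refine setDim_eq_sub_one (fun p hp => hp.1) ((lowerIneq w b).rhs - (lowerIneq w b).lhs)
    (fun p hp => sub_eq_zero.mpr hp.2.symm) ⟨_, ht₁⟩ (breveL_mem_feasible hLU hL)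
    (fun h => hL.ne ((tight_iff _).mp (sub_eq_zero.mp h).symm)) fun d hd hgd => ?_
  refine mem_of_coordinate_vectors_mem (J := {i | L i ≠ U i}) (s := w) (a := 0) (c := 0)
    (fun i hi => ?_) ?_ (fun i hi => vectorSpan_feasible_apply_eq_zero hd (not_not.mp hi))
    (fun i _ => rfl) ?_
  · obtain ⟨δ, hδ, hp⟩ := exists_perturbation_breveU hLU hU hi
    exact coordinate_vector_mem_vectorSpan hδ ht₁
      ⟨hp, (tight_iff _).mpr (affineFn_add_single ..)⟩
  · have h₀ : ((x, 0, 0, 0) : VarSpace n 0 1) ∈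
        {p | p ∈ (reluSystem w b L U).feasible ∧ (lowerIneq w b).Tight p} :=
      ⟨mem_feasible_iff.mpr ⟨hx, .inl ⟨rfl, rfl, hfx.le⟩⟩, (tight_iff _).mpr hfx⟩
    have h₁ : ((x, 0, 0, 1) : VarSpace n 0 1) ∈
        {p | p ∈ (reluSystem w b L U).feasible ∧ (lowerIneq w b).Tight p} :=
      ⟨mem_feasible_iff.mpr ⟨hx, .inr ⟨rfl, hfx.symm, hfx.ge⟩⟩, (tight_iff _).mpr hfx⟩
    simpa using vsub_mem_vectorSpan ℝ h₁ h₀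
  · rw [AffineMap.decomp'] at hgd
    simp only [Pi.sub_apply, AffineMap.coe_sub, lowerIneq_lhs_apply] at hgd
    simp only [lowerIneq, yVar_apply, affineFn, Prod.fst_zero, Prod.snd_zero, Pi.zero_apply,
      mul_zero, sub_zero, Finset.sum_const_zero] at hgd ⊢
    linear_combination hgd

end Facets

end NeuronMIP

theorem proposition5 (n : ℕ) (w : Fin n → ℝ) (b : ℝ) (L U : Fin n → ℝ) :
    (NeuronMIP.reluSystem w b L U).IsIdealFormulationOf
        (Set.graphOn (NeuronMIP.relu ∘ NeuronMIP.affineFn w b) (Set.Icc L U)) ∧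
      (NeuronMIP.IsIrreducibleNeuron (Set.Icc L U) ![NeuronMIP.affineFn w b, fun _ => 0] →
        (∀ I : Finset (Fin n),
            (NeuronMIP.reluSystem w b L U).IsFacetDefining (NeuronMIP.upperIneq w b L U I)) ∧
          (NeuronMIP.reluSystem w b L U).IsFacetDefining (NeuronMIP.lowerIneq w b)) :=  by
  refine ⟨⟨NeuronMIP.reluSystem_isFormulationOf w b L U,
    NeuronMIP.extremePoints_relaxation_subset w b L U⟩, fun hirr => ?_⟩
  obtain ⟨p, hp, hfp⟩ := hirr 0
  obtain ⟨q, hq, hfq⟩ := hirr 1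
  have hp0 : 0 < NeuronMIP.affineFn w b p := hfp 1 one_ne_zero
  have hq0 : NeuronMIP.affineFn w b q < 0 := hfq 0 zero_ne_one
  have hLU : L ≤ U := hp.1.trans hp.2
  have hL := (NeuronMIP.affineFn_breveL_le hq).trans_lt hq0
  have hU := hp0.trans_le (NeuronMIP.affineFn_le_breveU hp)
  exact ⟨NeuronMIP.isFacetDefining_upperIneq hLU hL hU,
    NeuronMIP.isFacetDefining_lowerIneq hLU hL hU⟩
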